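/- Theorem. Let $\mathcal{O}_2=\mathbb{Z}[i\sqrt2]\subset\mathbb{C}$, the ring of integers of $\mathbb{Q}(\sqrt{-2})$. Let $U(2,1)$ be the group of complex $3\times 3$ matrices that are unitary with respect to the Hermitian form $\langle z,w\rangle=z_1\bar w_3+z_2\bar w_2+z_3\bar w_1$ on $\mathbb{C}^3$, let $PU(2,1)=U(2,1)/U(1)$, where $U(1)=\{e^{i\theta}I:\theta\in\mathbb{R}\}$, and let $PU(2,1;\mathcal{O}_2)$ be the subgroup of $PU(2,1)$ consisting of the classes of the matrices in $U(2,1)$ with all entries in $\mathcal{O}_2$. Then $PU(2,1;\mathcal{O}_2)$ is generated by (the classes of) the five matrices $$I_0=\begin{bmatrix}0&0&1\\0&-1&0\\1&0&0\end{bmatrix},\quad R^{(2)}_1=\begin{bmatrix}1&0&0\\0&-1&0\\0&0&1\end{bmatrix},\quad R^{(2)}_2=\begin{bmatrix}1&2&-2\\0&-1&2\\0&0&1\end{bmatrix},$$ $$R^{(2)}_3=\begin{bmatrix}1&-i\sqrt2&-1\\0&-1&i\sqrt2\\0&0&1\end{bmatrix}\quad\text{and}\quad T^{(2)}=\begin{bmatrix}1&0&i\sqrt2\\0&1&0\\0&0&1\end{bmatrix}.$$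 -/

import Mathlib

namespace Picard

noncomputable section

open Matrix Complex
open scoped ComplexConjugate

/-- The Hermitian form `⟨z, w⟩ = z₁ w̄₃ + z₂ w̄₂ + z₃ w̄₁` of signature `(2,1)` on `ℂ³`. -/
def herm (z w : Fin 3 → ℂ) : ℂ :=
  z 0 * conj (w 2) + z 1 * conj (w 1) + z 2 * conj (w 0)

/-- The unitary group `U(2,1)` of the form `herm`. -/
def U21 : Subgroup (GL (Fin 3) ℂ) where
  carrier := {g | ∀ z w : Fin 3 → ℂ,
    herm ((g : Matrix (Fin 3) (Fin 3) ℂ) *ᵥ z) ((g : Matrix (Fin 3) (Fin 3) ℂ) *ᵥ w) = herm z w}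
  one_mem' := by intro z w; simp
  mul_mem' := by
    intro a b ha hb z w
    simp only [Units.val_mul, ← mulVec_mulVec]
    rw [ha, hb]
  inv_mem' := by
    intro a ha z w
    rw [← ha]
    simp only [mulVec_mulVec, Units.mul_inv, one_mulVec]

/-- The underlying complex `3 × 3` matrix of an element of `U(2,1)`. -/
def toMat (g : U21) : Matrix (Fin 3) (Fin 3) ℂ := ((g : GL (Fin 3) ℂ) : Matrix (Fin 3) (Fin 3) ℂ)

/-- The subgroup `U(1) = {e^{iθ} I}` of `U(2,1)`. -/
def scalars : Subgroup U21 where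
  carrier := {g | ∃ θ : ℝ, toMat g = Complex.exp (θ * Complex.I) • (1 : Matrix (Fin 3) (Fin 3) ℂ)}
  one_mem' := ⟨0, by simp [toMat]⟩
  mul_mem' := by
    rintro a b ⟨θ, ha⟩ ⟨φ, hb⟩
    refine ⟨θ + φ, ?_⟩
    have h : toMat (a * b) = toMat a * toMat b := rfl
    rw [h, ha, hb, Complex.ofReal_add, add_mul, Complex.exp_add]
    simp [smul_smul, mul_comm]
  inv_mem' := by
    rintro a ⟨θ, ha⟩
    refine ⟨-θ, ?_⟩
    have h : toMat a * toMat a⁻¹ = 1 := Units.mul_inv (a : GL (Fin 3) ℂ)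
    rw [ha, smul_mul_assoc, one_mul] at h
    rw [← h, smul_smul, ← Complex.exp_add]
    simp

instance scalars_normal : scalars.Normal where
  conj_mem := by
    rintro n ⟨θ, hn⟩ g
    refine ⟨θ, ?_⟩
    have h : toMat (g * n * g⁻¹) = toMat g * toMat n * toMat g⁻¹ := rfl
    have h' : toMat g * toMat g⁻¹ = 1 := Units.mul_inv (g : GL (Fin 3) ℂ)
    rw [h, hn, mul_smul_comm, mul_one, smul_mul_assoc, h']

/-- The projective unitary group `PU(2,1) = U(2,1) / U(1)`. -/
abbrev PU21 : Type := U21 ⧸ scalars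

/-- The class in `PU(2,1)` of an element of `U(2,1)`. -/
def toPU : U21 →* PU21 := QuotientGroup.mk' scalars

/-- The ring `𝒪₂ = ℤ[i√2]`, as a subring of `ℂ`. -/
def O2 : Subalgebra ℤ ℂ := Algebra.adjoin ℤ {Complex.I * (Real.sqrt 2 : ℂ)}

theorem conj_mem_O2 {x : ℂ} (hx : x ∈ O2) : conj x ∈ O2 := by
  induction hx using Algebra.adjoin_induction with
  | mem x hx =>
    rw [Set.mem_singleton_iff] at hx
    subst hx
    have h : conj (Complex.I * (Real.sqrt 2 : ℂ)) = -(Complex.I * (Real.sqrt 2 : ℂ)) := by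
      simp
    rw [h]
    exact neg_mem (Algebra.subset_adjoin rfl)
  | algebraMap r =>
    have h : conj ((algebraMap ℤ ℂ) r) = (algebraMap ℤ ℂ) r := by simp
    rw [h]
    exact O2.algebraMap_mem r
  | add x y _ _ hx hy => rw [map_add]; exact add_mem hx hy
  | mul x y _ _ hx hy => rw [map_mul]; exact mul_mem hx hy

/-- The Gram matrix of the form `herm`. -/
def J : Matrix (Fin 3) (Fin 3) ℂ := !![0, 0, 1; 0, 1, 0; 1, 0, 0]

theorem herm_eq (z w : Fin 3 → ℂ) : herm z w = star w ⬝ᵥ (J *ᵥ z) := by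
  simp [herm, J, mulVec, dotProduct, Fin.sum_univ_three]
  ring

theorem mem_U21_iff (g : GL (Fin 3) ℂ) :
    g ∈ U21 ↔ (g : Matrix (Fin 3) (Fin 3) ℂ)ᴴ * J * (g : Matrix (Fin 3) (Fin 3) ℂ) = J := by
  set M : Matrix (Fin 3) (Fin 3) ℂ := (g : Matrix (Fin 3) (Fin 3) ℂ) with hM
  have key : ∀ z w, herm (M *ᵥ z) (M *ᵥ w) = star w ⬝ᵥ ((Mᴴ * J * M) *ᵥ z) := by
    intro z w
    rw [herm_eq, star_mulVec, ← dotProduct_mulVec, mulVec_mulVec, mulVec_mulVec, Matrix.mul_assoc]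
  constructor
  · intro h
    ext i j
    have h1 := h (Pi.single j 1) (Pi.single i 1)
    rw [← hM, key, herm_eq] at h1
    simpa [← Pi.single_star, single_one_dotProduct] using h1
  · intro h z w
    rw [← hM, key, h, herm_eq]

theorem J_mul_J : J * J = 1 := by
  ext i j
  fin_cases i <;> fin_cases j <;> simp [J, Matrix.mul_apply, Fin.sum_univ_three]

theorem J_mem_O2 (i j : Fin 3) : J i j ∈ O2 := by
  fin_cases i <;> fin_cases j <;> simp [J]

theorem toMat_inv (g : U21) : toMat g⁻¹ = J * (toMat g)ᴴ * J := by
  have h : (toMat g)ᴴ * J * toMat g = J := (mem_U21_iff _).1 g.2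
  have h' : toMat g * toMat g⁻¹ = 1 := Units.mul_inv (g : GL (Fin 3) ℂ)
  calc toMat g⁻¹ = J * J * toMat g⁻¹ := by rw [J_mul_J, one_mul]
    _ = J * ((toMat g)ᴴ * J * toMat g) * toMat g⁻¹ := by rw [h]
    _ = J * (toMat g)ᴴ * J * (toMat g * toMat g⁻¹) := by simp only [Matrix.mul_assoc]
    _ = J * (toMat g)ᴴ * J := by rw [h', mul_one]

theorem mul_entries_mem_O2 {A B : Matrix (Fin 3) (Fin 3) ℂ} (hA : ∀ i j, A i j ∈ O2)
    (hB : ∀ i j, B i j ∈ O2) (i j : Fin 3) : (A * B) i j ∈ O2 := by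
  rw [Matrix.mul_apply]
  exact sum_mem fun k _ => mul_mem (hA i k) (hB k j)

/-- The group `U(2,1;𝒪₂)` of the elements of `U(2,1)` all of whose entries lie in `𝒪₂`. -/
def U21O2 : Subgroup U21 where
  carrier := {g | ∀ i j, toMat g i j ∈ O2}
  one_mem' := by
    intro i j
    have h : toMat 1 = 1 := rfl
    rw [h, Matrix.one_apply]
    split_ifs
    · exact one_mem _
    · exact zero_mem _
  mul_mem' := fun {_ _} ha hb => mul_entries_mem_O2 ha hb
  inv_mem' := by
    intro a ha
    show ∀ i j, toMat a⁻¹ i j ∈ O2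
    rw [toMat_inv]
    refine mul_entries_mem_O2 (mul_entries_mem_O2 J_mem_O2 fun i j => ?_) J_mem_O2
    exact conj_mem_O2 (ha j i)

/-- The Picard modular group `PU(2,1;𝒪₂)`: the image of `U(2,1;𝒪₂)` in `PU(2,1)`. -/
def PU21O2 : Subgroup PU21 := U21O2.map toPU

/-- The element of `U(2,1)` with matrix `M`, where `Mᴴ J M = J`. -/
def ofMat (M : Matrix (Fin 3) (Fin 3) ℂ) (h : Mᴴ * J * M = J) : U21 :=
  ⟨⟨M, J * Mᴴ * J, by
      refine mul_eq_one_comm.1 ?_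
      rw [Matrix.mul_assoc, Matrix.mul_assoc, ← Matrix.mul_assoc Mᴴ, h, J_mul_J], by
      rw [Matrix.mul_assoc, Matrix.mul_assoc, ← Matrix.mul_assoc Mᴴ, h, J_mul_J]⟩,
    (mem_U21_iff _).2 h⟩

theorem sqrt_two_mul_self : (Real.sqrt 2 : ℂ) * (Real.sqrt 2 : ℂ) = 2 := by
  rw [← Complex.ofReal_mul, Real.mul_self_sqrt (by norm_num)]
  norm_num

theorem I_sqrt_two_sq :
    Complex.I * (Real.sqrt 2 : ℂ) * (Complex.I * (Real.sqrt 2 : ℂ)) = -2 := by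
  linear_combination (Complex.I * Complex.I) * sqrt_two_mul_self + 2 * Complex.I_mul_I

/-- The matrix `I₀`. -/
def I0 : U21 := ofMat !![0, 0, 1; 0, -1, 0; 1, 0, 0] (by
  ext i j
  fin_cases i <;> fin_cases j <;> simp [J, Matrix.mul_apply, Fin.sum_univ_three])

/-- The matrix `R₁⁽²⁾`. -/
def R1 : U21 := ofMat !![1, 0, 0; 0, -1, 0; 0, 0, 1] (by
  ext i j
  fin_cases i <;> fin_cases j <;> simp [J, Matrix.mul_apply, Fin.sum_univ_three])

/-- The matrix `R₂⁽²⁾`. -/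
def R2 : U21 := ofMat !![1, 2, -2; 0, -1, 2; 0, 0, 1] (by
  have h2 : conj (2 : ℂ) = 2 := map_ofNat _ 2
  ext i j
  fin_cases i <;> fin_cases j <;> simp [J, Matrix.mul_apply, Fin.sum_univ_three, h2]
  norm_num)

/-- The matrix `R₃⁽²⁾`. -/
def R3 : U21 :=
  ofMat !![1, -(Complex.I * (Real.sqrt 2 : ℂ)), -1;
           0, -1, Complex.I * (Real.sqrt 2 : ℂ);
           0, 0, 1] (by
  have h := I_sqrt_two_sq
  ext i j
  fin_cases i <;> fin_cases j <;> simp [J, Matrix.mul_apply, Fin.sum_univ_three]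
  linear_combination -h)

/-- The matrix `T⁽²⁾`. -/
def T : U21 :=
  ofMat !![1, 0, Complex.I * (Real.sqrt 2 : ℂ);
           0, 1, 0;
           0, 0, 1] (by
  ext i j
  fin_cases i <;> fin_cases j <;> simp [J, Matrix.mul_apply, Fin.sum_univ_three])

end

end Picard

namespace Picard

noncomputable section

open Matrix Complex
open scoped ComplexConjugate

/-! The proof is a Euclidean descent on `|c|²`, where `(a, b, c)` is the first column of an integral
`g`. All words are formed in `U21`, inside the preimage `genGroup`, which contains `-1`. If `c = 0`,
then `g` fixes the cusp `∞`. As the units of `𝒪₂` are `±1`, multiplying by `-1` and `R1` makes `g` a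
Heisenberg translation, and these are generated (`heis_mem`). If `c ≠ 0`, put `A = a/c` and `Z =
b/c`, so that `2 Re A + |Z|² = 0`. Translations and `R1` bring `Z` into `0 ≤ Re Z ≤ 1`, `|Im Z| ≤
√2/2`. Away from the corners near `1 ± i√2/2`, a vertical translation followed by `I0` lowers
`|c|²`; near them a longer word does (`exists_descent`). Since `|c|²` is a natural number, the
descent ends. -/

/-! ### Arithmetic of `𝒪₂`: norms and units. -/

/-- The generator `i√2` of `𝒪₂`. -/
def ω : ℂ := Complex.I * (Real.sqrt 2 : ℂ)

theorem ω_mul_self : ω * ω = -2 := I_sqrt_two_sq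

theorem conj_ω : conj ω = -ω := by simp [ω]

theorem ω_re : ω.re = 0 := by simp [ω]

theorem ω_im : ω.im = √2 := by simp [ω]

theorem ω_mem_O2 : ω ∈ O2 := Algebra.subset_adjoin rfl

theorem mem_O2_iff {x : ℂ} : x ∈ O2 ↔ ∃ m n : ℤ, x = m + n * ω := by
  constructor
  · intro hx
    induction hx using Algebra.adjoin_induction with
    | mem x hx =>
      rw [Set.mem_singleton_iff] at hx
      exact ⟨0, 1, by simp [hx, ω]⟩
    | algebraMap r => exact ⟨r, 0, by simp⟩
    | add x y _ _ hx hy =>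
      obtain ⟨m, n, rfl⟩ := hx
      obtain ⟨p, q, rfl⟩ := hy
      exact ⟨m + p, n + q, by push_cast; ring⟩
    | mul x y _ _ hx hy =>
      obtain ⟨m, n, rfl⟩ := hx
      obtain ⟨p, q, rfl⟩ := hy
      exact ⟨m * p - 2 * (n * q), m * q + n * p, by
        push_cast; linear_combination (n * q : ℂ) * ω_mul_self⟩
  · rintro ⟨m, n, rfl⟩
    have hz (k : ℤ) : (k : ℂ) ∈ O2 := O2.algebraMap_mem k
    exact add_mem (hz m) (mul_mem (hz n) ω_mem_O2)

theorem normSq_int_add_int_mul_ω (m n : ℤ) :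
    normSq (m + n * ω) = ((m ^ 2 + 2 * n ^ 2 : ℤ) : ℝ) := by
  rw [normSq_apply]
  have h : √2 * √2 = 2 := Real.mul_self_sqrt (by norm_num)
  simp [ω_re, ω_im]
  linear_combination (n : ℝ) ^ 2 * h

theorem exists_nat_normSq_eq {x : ℂ} (hx : x ∈ O2) : ∃ n : ℕ, normSq x = n := by
  obtain ⟨m, n, rfl⟩ := mem_O2_iff.1 hx
  refine ⟨(m ^ 2 + 2 * n ^ 2).toNat, ?_⟩
  rw [normSq_int_add_int_mul_ω, ← Int.cast_natCast, Int.toNat_of_nonneg (by positivity)]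

theorem eq_one_or_eq_neg_one_of_normSq {x : ℂ} (hx : x ∈ O2) (h : normSq x = 1) :
    x = 1 ∨ x = -1 := by
  obtain ⟨m, n, rfl⟩ := mem_O2_iff.1 hx
  rw [normSq_int_add_int_mul_ω] at h
  have h1 : m ^ 2 + 2 * n ^ 2 = 1 := by exact_mod_cast h
  have hn : n = 0 := by
    by_contra hn
    have : 0 < n ^ 2 := by positivity
    nlinarith [sq_nonneg m]
  subst hn
  have hm : m = 1 ∨ m = -1 := by
    have : m ^ 2 = 1 := by linarith
    simpa using this
  rcases hm with rfl | rfl <;> simp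

theorem normSq_eq_one_of_mul_eq_one {x y : ℂ} (hx : x ∈ O2) (hy : y ∈ O2) (h : x * y = 1) :
    normSq x = 1 := by
  obtain ⟨m, hm⟩ := exists_nat_normSq_eq hx
  obtain ⟨n, hn⟩ := exists_nat_normSq_eq hy
  have h1 : normSq x * normSq y = 1 := by rw [← normSq_mul, h, normSq_one]
  rw [hm, hn] at h1
  have h2 : m * n = 1 := by exact_mod_cast h1
  rw [hm, Nat.eq_one_of_mul_eq_one_right h2, Nat.cast_one]

/-! ### Heisenberg translations. -/

theorem toMat_mul (g h : U21) : toMat (g * h) = toMat g * toMat h := rfl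

theorem toMat_ofMat (M : Matrix (Fin 3) (Fin 3) ℂ) (h : Mᴴ * J * M = J) :
    toMat (ofMat M h) = M := rfl

theorem toMat_injective : Function.Injective toMat :=
  fun _ _ h => Subtype.ext (Units.ext h)

/-- The Heisenberg translation by `2k + lω`, with vertical part `mω`. -/
def heis (k l m : ℤ) : U21 :=
  ofMat !![1, -(2 * k) + l * ω, -(2 * k ^ 2 + l ^ 2) + m * ω;
           0, 1, 2 * k + l * ω;
           0, 0, 1] (by
  have h2 : conj (2 : ℂ) = 2 := map_ofNat _ 2
  have h := ω_mul_self
  ext i j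
  fin_cases i <;> fin_cases j <;>
    simp [J, Matrix.mul_apply, Fin.sum_univ_three, h2, conj_ω] <;> try ring1
  linear_combination (l : ℂ) ^ 2 * (-h))

theorem heis_mul (k l m k' l' m' : ℤ) :
    heis k l m * heis k' l' m' =
      heis (k + k') (l + l') (m + m' + 2 * (l * k' - k * l')) := by
  apply toMat_injective
  have h := ω_mul_self
  rw [toMat_mul]
  ext i j
  fin_cases i <;> fin_cases j <;>
    simp [heis, toMat_ofMat, Matrix.mul_apply, Fin.sum_univ_three] <;> try ring1
  linear_combination (l * l' : ℂ) * h

theorem heis_zero : heis 0 0 0 = 1 := by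
  apply toMat_injective
  ext i j
  have h : toMat 1 = 1 := rfl
  rw [h]
  fin_cases i <;> fin_cases j <;> simp [heis, toMat_ofMat]

/-! ### The generated group contains the translations. -/

/-- The element `-1` of `U(2,1)`. -/
def negOne : U21 := ofMat (-1) (by simp)

theorem toPU_negOne : toPU negOne = 1 := by
  refine (QuotientGroup.eq_one_iff _).2 ⟨Real.pi, ?_⟩
  rw [Complex.exp_pi_mul_I, negOne, toMat_ofMat, neg_smul, one_smul]

/-- The preimage in `U(2,1)` of the group generated by the five classes. -/
def genGroup : Subgroup U21 :=
  (Subgroup.closure ({toPU I0, toPU R1, toPU R2, toPU R3, toPU T} : Set PU21)).comap toPU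

theorem I0_mem : I0 ∈ genGroup := Subgroup.subset_closure (by simp)
theorem R1_mem : R1 ∈ genGroup := Subgroup.subset_closure (by simp)
theorem R2_mem : R2 ∈ genGroup := Subgroup.subset_closure (by simp)
theorem R3_mem : R3 ∈ genGroup := Subgroup.subset_closure (by simp)
theorem T_mem : T ∈ genGroup := Subgroup.subset_closure (by simp)

theorem negOne_mem : negOne ∈ genGroup := by
  rw [genGroup, Subgroup.mem_comap, toPU_negOne]
  exact one_mem _

theorem heis_one_zero_zero : heis 1 0 0 = R2 * R1 := by
  apply toMat_injective
  rw [toMat_mul]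
  ext i j
  fin_cases i <;> fin_cases j <;>
    simp [heis, R1, R2, toMat_ofMat, Matrix.mul_apply, Fin.sum_univ_three]

theorem heis_zero_one_zero : heis 0 1 0 = R3 * R1 := by
  apply toMat_injective
  rw [toMat_mul]
  ext i j
  fin_cases i <;> fin_cases j <;>
    simp [heis, R1, R3, toMat_ofMat, Matrix.mul_apply, Fin.sum_univ_three, ω]

theorem heis_zero_zero_one : heis 0 0 1 = T := by
  apply toMat_injective
  ext i j
  fin_cases i <;> fin_cases j <;> simp [heis, T, toMat_ofMat, ω]

theorem heis_mem_of_zpow {f : ℤ → U21} (h0 : f 0 = 1) (hadd : ∀ k, f (k + 1) = f k * f 1)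
    (h1 : f 1 ∈ genGroup) (k : ℤ) : f k ∈ genGroup := by
  induction k using Int.induction_on with
  | zero => rw [h0]; exact one_mem _
  | succ k hk => rw [hadd]; exact mul_mem hk h1
  | pred k hk =>
    have h := hadd (-k - 1)
    rw [sub_add_cancel] at h
    rw [h] at hk
    exact (Subgroup.mul_mem_cancel_right _ h1).1 hk

theorem heis_mem (k l m : ℤ) : heis k l m ∈ genGroup := by
  have hA : heis k 0 0 ∈ genGroup :=
    heis_mem_of_zpow (f := fun k => heis k 0 0) heis_zero (fun k => by simp [heis_mul])
      (by simpa only [heis_one_zero_zero] using mul_mem R2_mem R1_mem) k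
  have hB : heis 0 l 0 ∈ genGroup :=
    heis_mem_of_zpow (f := fun l => heis 0 l 0) heis_zero (fun l => by simp [heis_mul])
      (by simpa only [heis_zero_one_zero] using mul_mem R3_mem R1_mem) l
  -- The horizontal translations do not commute: their product has vertical part `-2kl`, which the
  -- last factor must cancel.
  have hT : heis 0 0 (m + 2 * (k * l)) ∈ genGroup :=
    heis_mem_of_zpow (f := fun m => heis 0 0 m) heis_zero (fun m => by simp [heis_mul])
      (by simpa only [heis_zero_zero_one] using T_mem) _
  have h : heis k l m = heis k 0 0 * heis 0 l 0 * heis 0 0 (m + 2 * (k * l)) := by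
    simp [heis_mul]
  rw [h]
  exact mul_mem (mul_mem hA hB) hT

/-! ### Integrality of the generators. -/

theorem mem_U21O2 {g : U21} : g ∈ U21O2 ↔ ∀ i j, toMat g i j ∈ O2 := Iff.rfl

theorem I0_mem_U21O2 : I0 ∈ U21O2 := by
  intro i j
  fin_cases i <;> fin_cases j <;> simp [I0, toMat_ofMat]

theorem R1_mem_U21O2 : R1 ∈ U21O2 := by
  intro i j
  fin_cases i <;> fin_cases j <;> simp [R1, toMat_ofMat]

theorem negOne_mem_U21O2 : negOne ∈ U21O2 := by
  intro i j
  fin_cases i <;> fin_cases j <;> simp [negOne, toMat_ofMat]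

theorem heis_mem_U21O2 (k l m : ℤ) : heis k l m ∈ U21O2 := by
  intro i j
  rw [mem_O2_iff]
  fin_cases i <;> fin_cases j
  · exact ⟨1, 0, by simp [heis, toMat_ofMat]⟩
  · exact ⟨-(2 * k), l, by simp [heis, toMat_ofMat]⟩
  · exact ⟨-(2 * k ^ 2 + l ^ 2), m, by simp [heis, toMat_ofMat]⟩
  · exact ⟨0, 0, by simp [heis, toMat_ofMat]⟩
  · exact ⟨1, 0, by simp [heis, toMat_ofMat]⟩
  · exact ⟨2 * k, l, by simp [heis, toMat_ofMat]⟩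
  · exact ⟨0, 0, by simp [heis, toMat_ofMat]⟩
  · exact ⟨0, 0, by simp [heis, toMat_ofMat]⟩
  · exact ⟨1, 0, by simp [heis, toMat_ofMat]⟩

theorem R2_mem_U21O2 : R2 ∈ U21O2 :=
  (Subgroup.mul_mem_cancel_right _ R1_mem_U21O2).1
    (heis_one_zero_zero ▸ heis_mem_U21O2 1 0 0)

theorem R3_mem_U21O2 : R3 ∈ U21O2 :=
  (Subgroup.mul_mem_cancel_right _ R1_mem_U21O2).1
    (heis_zero_one_zero ▸ heis_mem_U21O2 0 1 0)

theorem T_mem_U21O2 : T ∈ U21O2 := heis_zero_zero_one ▸ heis_mem_U21O2 0 0 1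

/-! ### Unitarity relations and the stabiliser of the cusp. -/

theorem unitary_entry (g : U21) (i j : Fin 3) :
    conj (toMat g 2 i) * toMat g 0 j + conj (toMat g 1 i) * toMat g 1 j
      + conj (toMat g 0 i) * toMat g 2 j = J i j := by
  have h : (toMat g)ᴴ * J * toMat g = J := (mem_U21_iff _).1 g.2
  rw [← h]
  simp [J, Matrix.mul_apply, Fin.sum_univ_three]

/-- The first column is isotropic, being the image of the isotropic vector `e₁`. -/
theorem re_column_zero (g : U21) :
    2 * (conj (toMat g 2 0) * toMat g 0 0).re + normSq (toMat g 1 0) = 0 := by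
  have h := congrArg re (unitary_entry g 0 0)
  simp [J] at h
  simp [normSq_apply]
  linarith

theorem unipotent_mem {g : U21} (hg : g ∈ U21O2) (h00 : toMat g 0 0 = 1) (h10 : toMat g 1 0 = 0)
    (h20 : toMat g 2 0 = 0) (h11 : toMat g 1 1 = 1) : g ∈ genGroup := by
  have e01 := unitary_entry g 0 1
  have e02 := unitary_entry g 0 2
  have e12 := unitary_entry g 1 2
  have e22 := unitary_entry g 2 2
  simp [J, h00, h10, h20] at e01 e02
  simp [J, h11, e01, e02] at e12 e22
  obtain ⟨p, q, hpq⟩ := mem_O2_iff.1 (mem_U21O2.1 hg 1 2)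
  obtain ⟨r, m, hrm⟩ := mem_O2_iff.1 (mem_U21O2.1 hg 0 2)
  have e : p ^ 2 + 2 * q ^ 2 + 2 * r = 0 := by
    rw [hpq, hrm] at e22
    simp [conj_ω] at e22
    have h : (p : ℂ) ^ 2 + 2 * q ^ 2 + 2 * r = 0 := by
      linear_combination e22 + (q : ℂ) ^ 2 * ω_mul_self
    exact_mod_cast h
  -- Isotropy of the last column forces `p` to be even; hence the horizontal parts `2k + lω` in
  -- `heis`.
  obtain ⟨k, rfl⟩ : (2 : ℤ) ∣ p := by
    refine Int.prime_two.dvd_of_dvd_pow (n := 2) ⟨-(q ^ 2 + r), by linarith⟩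
  obtain rfl : r = -(2 * k ^ 2 + q ^ 2) := by linarith
  have e01' : toMat g 0 1 = -(2 * k) + q * ω := by
    have h := congrArg conj e12
    rw [hpq] at h
    simp [conj_ω, map_ofNat] at h
    linear_combination h
  suffices g = heis k q m by rw [this]; exact heis_mem _ _ _
  apply toMat_injective
  ext i j
  fin_cases i <;> fin_cases j <;>
    simp [heis, toMat_ofMat, h00, h10, h20, h11, e01, e02, e01', hpq, hrm]

theorem negOne_mul_apply (g : U21) (i j : Fin 3) : toMat (negOne * g) i j = -toMat g i j := by
  simp [toMat_mul, negOne, toMat_ofMat]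

theorem R1_mul_apply_zero (g : U21) (j : Fin 3) : toMat (R1 * g) 0 j = toMat g 0 j := by
  simp [toMat_mul, R1, toMat_ofMat, Matrix.mul_apply, Fin.sum_univ_three]

theorem R1_mul_apply_one (g : U21) (j : Fin 3) : toMat (R1 * g) 1 j = -toMat g 1 j := by
  simp [toMat_mul, R1, toMat_ofMat, Matrix.mul_apply, Fin.sum_univ_three]

theorem R1_mul_apply_two (g : U21) (j : Fin 3) : toMat (R1 * g) 2 j = toMat g 2 j := by
  simp [toMat_mul, R1, toMat_ofMat, Matrix.mul_apply, Fin.sum_univ_three]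

theorem I0_mul_apply_zero (g : U21) (j : Fin 3) : toMat (I0 * g) 0 j = toMat g 2 j := by
  simp [toMat_mul, I0, toMat_ofMat, Matrix.mul_apply, Fin.sum_univ_three]

theorem I0_mul_apply_one (g : U21) (j : Fin 3) : toMat (I0 * g) 1 j = -toMat g 1 j := by
  simp [toMat_mul, I0, toMat_ofMat, Matrix.mul_apply, Fin.sum_univ_three]

theorem I0_mul_apply_two (g : U21) (j : Fin 3) : toMat (I0 * g) 2 j = toMat g 0 j := by
  simp [toMat_mul, I0, toMat_ofMat, Matrix.mul_apply, Fin.sum_univ_three]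

theorem heis_mul_apply_zero (k l m : ℤ) (g : U21) (j : Fin 3) :
    toMat (heis k l m * g) 0 j = toMat g 0 j + (-(2 * k) + l * ω) * toMat g 1 j
      + (-(2 * k ^ 2 + l ^ 2) + m * ω) * toMat g 2 j := by
  simp [toMat_mul, heis, toMat_ofMat, Matrix.mul_apply, Fin.sum_univ_three]

theorem heis_mul_apply_one (k l m : ℤ) (g : U21) (j : Fin 3) :
    toMat (heis k l m * g) 1 j = toMat g 1 j + (2 * k + l * ω) * toMat g 2 j := by
  simp [toMat_mul, heis, toMat_ofMat, Matrix.mul_apply, Fin.sum_univ_three]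

theorem heis_mul_apply_two (k l m : ℤ) (g : U21) (j : Fin 3) :
    toMat (heis k l m * g) 2 j = toMat g 2 j := by
  simp [toMat_mul, heis, toMat_ofMat, Matrix.mul_apply, Fin.sum_univ_three]

/-- The stabiliser of the cusp `∞` in `U(2,1;𝒪₂)` lies in the generated group. -/
theorem mem_genGroup_of_apply_two_zero {g : U21} (hg : g ∈ U21O2) (h20 : toMat g 2 0 = 0) :
    g ∈ genGroup := by
  have h10 : toMat g 1 0 = 0 := by
    have h := re_column_zero g
    simpa [h20] using h
  wlog h00 : toMat g 0 0 = 1 generalizing g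
  · have e02 := unitary_entry g 0 2
    simp [J, h10, h20] at e02
    have hn := normSq_eq_one_of_mul_eq_one (conj_mem_O2 (hg 0 0)) (hg 2 2) e02
    rw [normSq_conj] at hn
    have h00' := (eq_one_or_eq_neg_one_of_normSq (hg 0 0) hn).resolve_left h00
    refine (Subgroup.mul_mem_cancel_left _ negOne_mem).1
      (this (mul_mem negOne_mem_U21O2 hg) ?_ ?_ ?_) <;>
      simp [negOne_mul_apply, h20, h10, h00']
  by_cases h11 : toMat g 1 1 = 1
  · exact unipotent_mem hg h00 h10 h20 h11
  · have e01 := unitary_entry g 0 1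
    have e11 := unitary_entry g 1 1
    simp [J, h10, h20, h00] at e01
    simp [J, e01] at e11
    have hn := normSq_eq_one_of_mul_eq_one (conj_mem_O2 (hg 1 1)) (hg 1 1) e11
    rw [normSq_conj] at hn
    have h11' := (eq_one_or_eq_neg_one_of_normSq (hg 1 1) hn).resolve_left h11
    refine (Subgroup.mul_mem_cancel_left _ R1_mem).1
      (unipotent_mem (mul_mem R1_mem_U21O2 hg) ?_ ?_ ?_ ?_) <;>
      simp [R1_mul_apply_zero, R1_mul_apply_one, R1_mul_apply_two, h20, h10, h00, h11']

/-! ### Covering the rectangle by isometric spheres. -/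

theorem exists_int_abs_add_mul_le (x : ℝ) {d : ℝ} (hd : 0 < d) : ∃ n : ℤ, |x + n * d| ≤ d / 2 := by
  refine ⟨-round (x / d), ?_⟩
  have h := abs_sub_round (x / d)
  have e : x + ((-round (x / d) : ℤ) : ℝ) * d = (x / d - round (x / d)) * d := by
    push_cast
    field_simp
    ring
  rw [e, abs_mul, abs_of_pos hd]
  nlinarith

theorem sq_le_half_of_abs_le {x : ℝ} (h : |x| ≤ √2 / 2) : x * x ≤ 1 / 2 := by
  have h2 : √2 * √2 = 2 := Real.mul_self_sqrt (by norm_num)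
  have h3 := abs_mul_abs_self x
  nlinarith [abs_nonneg x]

/-- Points of small horizontal part lie, up to a vertical translation, inside the isometric sphere
of `I₀`. -/
theorem exists_normSq_add_lt_one {A Z : ℂ} (h : 2 * A.re + normSq Z = 0)
    (hZ : normSq Z < 1.41) : ∃ m : ℤ, normSq (A + m * ω) < 1 := by
  obtain ⟨m, hm⟩ := exists_int_abs_add_mul_le A.im (show (0 : ℝ) < √2 by positivity)
  refine ⟨m, ?_⟩
  have h1 := sq_le_half_of_abs_le hm
  rw [normSq_apply (A + m * ω)]
  simp [ω_re, ω_im]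
  -- With `Re A = -|Z|²/2` the norm is at most `1.41²/4 + 1/2 < 1`; the constant `1.41` is just
  -- below the critical value `√2`.
  nlinarith [normSq_nonneg Z]

/-- Points whose horizontal part is near the corners of the fundamental rectangle lie inside an
isometric sphere centred over `1`. -/
theorem exists_normSq_sub_lt_one {A Z : ℂ} (h : 2 * A.re + normSq Z = 0)
    (h0 : 0 ≤ Z.re) (h1 : Z.re ≤ 1) (hi : Z.im * Z.im ≤ 1 / 2) (hZ : 1.41 ≤ normSq Z) :
    ∃ n : ℤ, normSq (2 * A + 2 * Z - 1 - n * ω) < 1 := by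
  obtain ⟨m, hm⟩ := exists_int_abs_add_mul_le (2 * A.im + 2 * Z.im) (show (0 : ℝ) < √2 by positivity)
  refine ⟨-m, ?_⟩
  have h2 := sq_le_half_of_abs_le hm
  rw [normSq_apply] at h hZ
  -- `(Re Z)² ≥ 1.41 - 1/2 = 0.91 > 0.95²`.
  have h3 : 0.95 ≤ Z.re := by nlinarith
  -- This real part is `-|Z - 1|²`, so the final bound is `0.51² + 1/2 < 1`.
  have e : 2 * A.re + 2 * Z.re - 1 = -((Z.re - 1) ^ 2 + Z.im * Z.im) := by linarith
  have h4 : (Z.re - 1) ^ 2 ≤ 0.01 := by nlinarith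
  rw [normSq_apply]
  simp [ω_re, ω_im]
  rw [e]
  have h5 : (Z.re - 1) ^ 2 + Z.im * Z.im ≤ 0.51 := by linarith
  have h6 : 0 ≤ (Z.re - 1) ^ 2 + Z.im * Z.im := by nlinarith [mul_self_nonneg Z.im]
  nlinarith

/-! ### The descent. -/

/-- Realises, up to sign, the bottom row `(2, 2, -(1 + nω))` used near the corners. The initial
vertical translation by `-mω` changes `n` by `2m`, so each parity needs its own word. -/
theorem exists_apply_two_zero_of_odd_or_even (g : U21) (n : ℤ) :
    ∃ h ∈ genGroup ⊓ U21O2, normSq (toMat (h * g) 2 0) =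
      normSq (2 * toMat g 0 0 + 2 * toMat g 1 0 - (1 + n * ω) * toMat g 2 0) := by
  have hI : I0 ∈ genGroup ⊓ U21O2 := ⟨I0_mem, I0_mem_U21O2⟩
  have hH (k l m : ℤ) : heis k l m ∈ genGroup ⊓ U21O2 := ⟨heis_mem k l m, heis_mem_U21O2 k l m⟩
  obtain ⟨m, rfl | rfl⟩ := Int.even_or_odd' n
  · refine ⟨I0 * (heis (-1) 0 0 * (I0 * heis 0 0 (-m))),
      mul_mem hI (mul_mem (hH _ _ _) (mul_mem hI (hH _ _ _))), ?_⟩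
    -- The even word yields the negative of the desired combination.
    rw [← normSq_neg]
    congr 1
    simp only [mul_assoc, I0_mul_apply_zero, I0_mul_apply_one, I0_mul_apply_two,
      heis_mul_apply_zero, heis_mul_apply_one, heis_mul_apply_two]
    push_cast
    ring
  · refine ⟨I0 * (heis 0 1 (-1) * (I0 * (heis 0 (-1) 1 * (I0 * heis 0 0 (-m))))),
      mul_mem hI (mul_mem (hH _ _ _) (mul_mem hI (mul_mem (hH _ _ _) (mul_mem hI (hH _ _ _))))), ?_⟩
    congr 1
    simp only [mul_assoc, I0_mul_apply_zero, I0_mul_apply_one, I0_mul_apply_two,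
      heis_mul_apply_zero, heis_mul_apply_one, heis_mul_apply_two]
    push_cast
    linear_combination (-toMat g 1 0) * ω_mul_self

theorem normSq_lt_of_div {x c : ℂ} (hc : c ≠ 0) (h : normSq (x / c) < 1) :
    normSq x < normSq c := by
  rwa [normSq_div, div_lt_one (normSq_pos.2 hc)] at h

theorem re_div_column_zero (g : U21) (hc : toMat g 2 0 ≠ 0) :
    2 * (toMat g 0 0 / toMat g 2 0).re + normSq (toMat g 1 0 / toMat g 2 0) = 0 := by
  have h := re_column_zero g
  have hp := normSq_pos.2 hc
  rw [normSq_div, div_re]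
  simp at h
  field_simp
  linarith

/-- The descent step for a first column whose horizontal part lies in the right half of the
fundamental rectangle. -/
theorem exists_descent_of_mem_rectangle {g : U21} (hc : toMat g 2 0 ≠ 0)
    (h0 : 0 ≤ (toMat g 1 0 / toMat g 2 0).re) (h1 : (toMat g 1 0 / toMat g 2 0).re ≤ 1)
    (hi : (toMat g 1 0 / toMat g 2 0).im * (toMat g 1 0 / toMat g 2 0).im ≤ 1 / 2) :
    ∃ h ∈ genGroup ⊓ U21O2, normSq (toMat (h * g) 2 0) < normSq (toMat g 2 0) := by
  have hre := re_div_column_zero g hc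
  rcases lt_or_ge (normSq (toMat g 1 0 / toMat g 2 0)) 1.41 with hZ | hZ
  · obtain ⟨m, hm⟩ := exists_normSq_add_lt_one hre hZ
    refine ⟨I0 * heis 0 0 m, mul_mem ⟨I0_mem, I0_mem_U21O2⟩ ⟨heis_mem _ _ _, heis_mem_U21O2 _ _ _⟩,
      normSq_lt_of_div hc ?_⟩
    convert hm using 2
    rw [mul_assoc, I0_mul_apply_two, heis_mul_apply_zero]
    field_simp
    push_cast
    ring
  · obtain ⟨n, hn⟩ := exists_normSq_sub_lt_one hre h0 h1 hi hZ
    obtain ⟨h, hh, e⟩ := exists_apply_two_zero_of_odd_or_even g n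
    refine ⟨h, hh, ?_⟩
    rw [e]
    apply normSq_lt_of_div hc
    convert hn using 2
    field_simp
    ring

theorem exists_descent {g : U21} (hc : toMat g 2 0 ≠ 0) :
    ∃ h ∈ genGroup ⊓ U21O2, normSq (toMat (h * g) 2 0) < normSq (toMat g 2 0) := by
  set Z := toMat g 1 0 / toMat g 2 0 with hZ
  obtain ⟨k, hk⟩ := exists_int_abs_add_mul_le Z.re (show (0 : ℝ) < 2 by norm_num)
  obtain ⟨l, hl⟩ := exists_int_abs_add_mul_le Z.im (show (0 : ℝ) < √2 by positivity)
  have hl2 := sq_le_half_of_abs_le hl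
  rw [div_self two_ne_zero, abs_le] at hk
  have hH : heis k l 0 ∈ genGroup ⊓ U21O2 := ⟨heis_mem _ _ _, heis_mem_U21O2 _ _ _⟩
  have hR : R1 ∈ genGroup ⊓ U21O2 := ⟨R1_mem, R1_mem_U21O2⟩
  have h2 : toMat (heis k l 0 * g) 2 0 = toMat g 2 0 := heis_mul_apply_two ..
  have hd : toMat (heis k l 0 * g) 1 0 / toMat g 2 0 = Z + (2 * k + l * ω) := by
    rw [heis_mul_apply_one, hZ]
    field_simp
  have hre : (Z + (2 * k + l * ω)).re = Z.re + k * 2 := by simp [ω_re]; ring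
  have him : (Z + (2 * k + l * ω)).im = Z.im + l * √2 := by simp [ω_im]
  rcases le_total 0 (Z.re + k * 2) with h0 | h0
  · obtain ⟨h, hh, hlt⟩ := exists_descent_of_mem_rectangle (g := heis k l 0 * g)
      (by rwa [h2]) (by rwa [h2, hd, hre]) (by rw [h2, hd, hre]; exact hk.2)
      (by rwa [h2, hd, him])
    rw [h2, ← mul_assoc] at hlt
    exact ⟨_, mul_mem hh hH, hlt⟩
  -- `R1` sends `Z` to `-Z` and fixes `a` and `c`, which reflects the left half of the rectangle
  -- into the right half.
  · have h2' : toMat (R1 * (heis k l 0 * g)) 2 0 = toMat g 2 0 := by rw [R1_mul_apply_two, h2]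
    have hd' : toMat (R1 * (heis k l 0 * g)) 1 0 / toMat g 2 0 = -(Z + (2 * k + l * ω)) := by
      rw [R1_mul_apply_one, neg_div, hd]
    obtain ⟨h, hh, hlt⟩ := exists_descent_of_mem_rectangle (g := R1 * (heis k l 0 * g))
      (by rwa [h2']) (by rw [h2', hd', neg_re, hre]; linarith)
      (by rw [h2', hd', neg_re, hre]; linarith)
      (by rwa [h2', hd', neg_im, him, neg_mul_neg])
    rw [h2', ← mul_assoc, ← mul_assoc] at hlt
    exact ⟨_, mul_mem (mul_mem hh hR) hH, hlt⟩

theorem U21O2_le_genGroup : U21O2 ≤ genGroup := by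
  intro g hg
  obtain ⟨n, hn⟩ := exists_nat_normSq_eq (hg 2 0)
  induction n using Nat.strong_induction_on generalizing g with
  | _ n ih =>
    by_cases hc : toMat g 2 0 = 0
    · exact mem_genGroup_of_apply_two_zero hg hc
    · obtain ⟨h, ⟨hh, hh'⟩, hlt⟩ := exists_descent hc
      -- Integrality of `h` keeps the new lower-left norm a natural number, so the induction applies
      -- to `h * g`.
      have hhg := mul_mem hh' hg
      obtain ⟨m, hm⟩ := exists_nat_normSq_eq (hhg 2 0)
      rw [hm, hn, Nat.cast_lt] at hlt
      exact (Subgroup.mul_mem_cancel_left _ hh).1 (ih m hlt hhg hm)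

end

end Picard

theorem mainTheorem1 :
    Subgroup.closure
      ({Picard.toPU Picard.I0, Picard.toPU Picard.R1, Picard.toPU Picard.R2,
        Picard.toPU Picard.R3, Picard.toPU Picard.T} : Set Picard.PU21) = Picard.PU21O2 := by
  apply le_antisymm
  · rw [Subgroup.closure_le]
    rintro _ (rfl | rfl | rfl | rfl | rfl)
    · exact ⟨_, Picard.I0_mem_U21O2, rfl⟩
    · exact ⟨_, Picard.R1_mem_U21O2, rfl⟩
    · exact ⟨_, Picard.R2_mem_U21O2, rfl⟩
    · exact ⟨_, Picard.R3_mem_U21O2, rfl⟩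
    · exact ⟨_, Picard.T_mem_U21O2, rfl⟩
  · exact Subgroup.map_le_iff_le_comap.2 Picard.U21O2_le_genGroup
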